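/- Logarithms are to base $2$. For $k\ge 2$ and a Boolean function $f$ of $k$ inputs, let $D_k(f)$ be its deterministic number-on-the-forehead communication complexity: the least $t$ such that some protocol, in which the $k$ players write single bits on a blackboard, each bit depending only on the previous bits and on the inputs other than the writer's own, and in which the final transcript determines the output, computes $f$ and writes at most $t$ bits on every input. For $A : X^{k-1}\to Y$ let $\mathrm{Lift}(A) : X^{k-1}\times Y\to\{0,1\}$ be the graph function with $\mathrm{Lift}(A)(x_1,\dots,x_{k-1},y)=1$ if and only if $A(x_1,\dots,x_{k-1})=y$. For a prime power $N$ let $T_{N,d,m} : (\mathbb F_N^{d\times d})^m\to\mathbb F_N$, $T_{N,d,m}(B_1,\dots,B_m)=\mathrm{Tr}(B_1B_2\cdots B_m)$. There is an absolute constant $c_0>0$ such that for every real $c\ge c_0$ and every real $a$ there is a $\delta>0$ (depending only on $c$ and $a$) for which the following holds. Let $N$ be a prime power, let $k\ge 2$ be an integer, let $$d=\Big\lceil c\,k^{3/2}\,2^{k/2}\sqrt{N/\log N}\,\Big\rceil ,$$ let $A=T_{N,d,k-1}$ and $f=\mathrm{Lift}(A)$, and let $n=|\mathbb F_N^{d\times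 d}|=N^{d^2}$, so that $f$ is an explicit graph function with domain $[n]^{k-1}\times[N]$ (up to naming the inputs). Then 1. $D_k(f)\ge\log N$; 2. $\log N\ge \log\log n-k-3\log k-2\log(c+1)$; 3. if $k\le N^{a}$, then $\log N\ge\delta\,(\log\log n-k)$; 4. if $k\le a\log N$, then $\log N\ge\delta\,\log\log n$. That is, $D_k(f)\ge\log N\ge\Omega(\log\log n-k)$ as long as $k$ is at most polynomial in $N$, and $D_k(f)\ge\Omega(\log\log n)$ as long as $k=O(\log N)$, in particular for every fixed $k$. -/

import Mathlib

universe u v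

/-- A deterministic number-on-the-forehead protocol for players indexed by `ι`, where player `i`
has an input in `X i` on the forehead. At an inner node of the tree (which is determined by what
is written on the blackboard so far) some player `i` writes one bit, which may depend on all the
inputs except the one of player `i`. At a leaf the transcript determines the Boolean output. -/
inductive NOFProtocol {ι : Type v} (X : ι → Type u) : Type (max u v) where
  | output (z : Bool) : NOFProtocol X
  | speak (i : ι) (bit : ((j : {j : ι // j ≠ i}) → X j) → Bool)
      (next : Bool → NOFProtocol X) : NOFProtocol X

namespace NOFProtocol

variable {ι : Type v} {X : ι → Type u}

/-- What player `i` sees on the input `x`: all the inputs except the one of player `i`. -/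
def view (x : (j : ι) → X j) (i : ι) : (j : {j : ι // j ≠ i}) → X j := fun j => x j

/-- The output of the protocol on the input `x`. -/
def eval : NOFProtocol X → ((j : ι) → X j) → Bool
  | output z, _ => z
  | speak i bit next, x => eval (next (bit (view x i))) x

/-- The number of bits written on the blackboard on the input `x`. -/
def bits : NOFProtocol X → ((j : ι) → X j) → ℕ
  | output _, _ => 0
  | speak i bit next, x => bits (next (bit (view x i))) x + 1

end NOFProtocol

/-- The deterministic number-on-the-forehead communication complexity of `f`: the least `t` such
that some protocol computes `f` and writes at most `t` bits on every input. -/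
noncomputable def detNOF {ι : Type v} {X : ι → Type u} (f : ((j : ι) → X j) → Bool) : ℕ :=
  sInf {t : ℕ | ∃ P : NOFProtocol X, ∀ x, P.eval x = f x ∧ P.bits x ≤ t}

namespace NOFProtocol

variable {ι : Type v} {X : ι → Type u}

/-- The protocol that asks a fixed list of questions, each to one player, and then outputs a
function of the answers. -/
def ask : List ((i : ι) × (((j : {j : ι // j ≠ i}) → X j) → Bool)) → (List Bool → Bool) →
    NOFProtocol X
  | [], g => output (g [])
  | q :: qs, g => speak q.1 q.2 (fun b => ask qs (fun l => g (b :: l)))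

theorem eval_ask (qs : List ((i : ι) × (((j : {j : ι // j ≠ i}) → X j) → Bool)))
    (g : List Bool → Bool) (x : (j : ι) → X j) :
    (ask qs g).eval x = g (qs.map fun q => q.2 (view x q.1)) ∧
      (ask qs g).bits x ≤ qs.length := by
  induction qs generalizing g with
  | nil => simp [ask, eval, bits]
  | cons q qs ih =>
    have h := ih (fun l => g (q.2 (view x q.1) :: l))
    simp only [ask, eval, bits, List.map_cons, List.length_cons]
    exact ⟨h.1, Nat.succ_le_succ h.2⟩

end NOFProtocol

/-- With at least two players and finite input spaces every function has a protocol, so that the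
infimum in `detNOF` is attained. -/
theorem exists_protocol_detNOF {ι : Type v} {X : ι → Type u} [Finite ι] [Nontrivial ι]
    [∀ j, Finite (X j)] (f : ((j : ι) → X j) → Bool) :
    ∃ P : NOFProtocol X, ∀ x, P.eval x = f x ∧ P.bits x ≤ detNOF f := by
  classical
  suffices h : {t : ℕ | ∃ P : NOFProtocol X, ∀ x, P.eval x = f x ∧ P.bits x ≤ t}.Nonempty from
    Nat.sInf_mem h
  cases nonempty_fintype ι
  have : ∀ j, Fintype (X j) := fun j => Fintype.ofFinite _
  choose w hw using fun j : ι => exists_ne j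
  let Q : ((j : ι) × X j) → ((i : ι) × (((j : {j : ι // j ≠ i}) → X j) → Bool)) :=
    fun p => ⟨w p.1, fun y => decide (y ⟨p.1, (hw p.1).symm⟩ = p.2)⟩
  let qs := (Finset.univ : Finset ((j : ι) × X j)).toList.map Q
  let ans : ((j : ι) → X j) → List Bool := fun x => qs.map fun q => q.2 (NOFProtocol.view x q.1)
  have hinj : Function.Injective ans := by
    intro x y hxy
    funext j
    simp only [ans, qs, List.map_map] at hxy
    have h := List.map_inj_left.1 hxy ⟨j, x j⟩ (Finset.mem_toList.2 (Finset.mem_univ _))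
    change decide (x j = x j) = decide (y j = x j) at h
    exact ((decide_eq_decide.1 h).1 rfl).symm
  let g : List Bool → Bool := fun l => decide (∃ x, ans x = l ∧ f x = true)
  refine ⟨qs.length, NOFProtocol.ask qs g, fun x => ?_⟩
  obtain ⟨h1, h2⟩ := NOFProtocol.eval_ask qs g x
  refine ⟨h1.trans ?_, h2⟩
  change decide (∃ z, ans z = ans x ∧ f z = true) = f x
  have key : (∃ z, ans z = ans x ∧ f z = true) ↔ f x = true :=
    ⟨fun ⟨z, hz, hf⟩ => hinj hz ▸ hf, fun h => ⟨x, rfl, h⟩⟩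
  rw [Bool.eq_iff_iff, decide_eq_true_iff]
  exact key

/-- The input spaces for a graph function: the first `m` players `some 0, …, some (m - 1)` have
inputs in `X`, and the last player `none` has an input in `Y`. There are `m + 1` players. -/
def GraphInput (m : ℕ) (X Y : Type u) : Option (Fin m) → Type u
  | some _ => X
  | none => Y

open Classical in
/-- The graph function `Lift A` of `A : X ^ m → Y`, which is `1` on `(x₁, …, xₘ, y)` if and only
if `A (x₁, …, xₘ) = y`. -/
noncomputable def Lift {m : ℕ} {X Y : Type u} (A : (Fin m → X) → Y) :
    ((j : Option (Fin m)) → GraphInput m X Y j) → Bool :=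
  fun z => decide (A (fun i => z (some i)) = z none)

/-- The trace of the product `B₁ B₂ ⋯ Bₘ` of `m` matrices of size `d × d` over `F`. -/
def traceProd (F : Type u) [Field F] (d m : ℕ) : (Fin m → Matrix (Fin d) (Fin d) F) → F :=
  fun B => Matrix.trace (List.ofFn B).prod

/-! Write `N` for the number of values of `A : X ^ m → F`. A protocol writing `t` bits partitions
the graph of `A` into at most `2 ^ t` cylinder intersections, so it suffices that `N * |S|` is
essentially at most `|X| ^ m` for every cylinder intersection `S` inside the graph. For each value
`v`, the inputs `x` for which the first `m` players do not exclude `(x, v)` from `S` form a cylinder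
intersection `D v` in `X ^ m`. Since the last player does not see the value and `S` lies in the
graph, a point `(x, v)` of `S` has `x ∈ D v` and `x ∉ D w` for `w ≠ v`. The sets
`D v \ ⋃ w ≠ v, D w` are pairwise disjoint, and by inclusion–exclusion and Fourier inversion `A`
takes the value `v` on roughly a fraction `1 / N` of each, provided that the character sums of `A`
over cylinder intersections are small.

For the trace of a matrix product, the Cauchy–Schwarz argument of Babai, Nisan and Szegedy bounds
these sums by the probability that a product of `m - 1` random `d × d` matrices vanishes. If `s` is
about `d / m`, this forces one factor to have corank more than `s`, which happens with probability
about `N ^ (-s ^ 2)`. -/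

open Finset Module
open scoped BigOperators ComplexConjugate

section Rank

variable {m n o F : Type*} [Fintype n] [Fintype o] [Field F]

theorem finrank_ker_comp_le {U V W : Type*} [AddCommGroup U] [Module F U] [FiniteDimensional F U]
    [AddCommGroup V] [Module F V] [FiniteDimensional F V] [AddCommGroup W] [Module F W]
    (f : V →ₗ[F] W) (g : U →ₗ[F] V) :
    finrank F (f ∘ₗ g).ker ≤ finrank F f.ker + finrank F g.ker := by
  let h : (f ∘ₗ g).ker →ₗ[F] f.ker := g.restrict fun _ hx ↦ hx
  have hker : finrank F h.ker ≤ finrank F g.ker := by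
    refine (Submodule.finrank_map_subtype_eq _ _).symm.trans_le (Submodule.finrank_mono ?_)
    rintro _ ⟨x, hx, rfl⟩
    exact congrArg Subtype.val hx
  have hrange : finrank F h.range ≤ finrank F f.ker := Submodule.finrank_le _
  have := h.finrank_range_add_finrank_ker
  lia

theorem rank_add_rank_le_rank_mul_add_card (A : Matrix m n F) (B : Matrix n o F) :
    A.rank + B.rank ≤ (A * B).rank + Fintype.card n := by
  have hker := finrank_ker_comp_le A.mulVecLin B.mulVecLin
  have hA := A.mulVecLin.finrank_range_add_finrank_ker
  have hB := B.mulVecLin.finrank_range_add_finrank_ker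
  have hAB := (A * B).mulVecLin.finrank_range_add_finrank_ker
  rw [← Matrix.mulVecLin_mul] at hker
  rw [finrank_fintype_fun_eq_card] at hA hB hAB
  unfold Matrix.rank
  lia

theorem exists_finset_card_eq_rank_row_mem_span [Finite m] (A : Matrix m n F) :
    ∃ I : Finset m, #I = A.rank ∧ ∀ i, A.row i ∈ Submodule.span F (A.row '' I) := by
  classical
  have := Fintype.ofFinite m
  obtain ⟨b, -, -, hspan, hli⟩ := exists_linearIndepOn_extension (K := F) (v := A.row)
    (linearIndepOn_empty F A.row) (Set.subset_univ _)
  rw [Set.image_univ] at hspan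
  refine ⟨b.toFinset, ?_, fun i ↦ ?_⟩
  · have hb : Submodule.span F (Set.range A.row) = Submodule.span F (A.row '' b) :=
      (Submodule.span_le.2 hspan).antisymm (Submodule.span_mono (Set.image_subset_range _ _))
    rw [A.rank_eq_finrank_span_row, hb, Set.image_eq_range, finrank_span_eq_card hli,
      Set.toFinset_card]
  · rw [Set.coe_toFinset]
    exact hspan (Set.mem_range_self i)

variable [Fintype m] [Fintype F]

open Classical in
theorem card_row_mem_span_le [DecidableEq m] [DecidableEq n] (I : Finset m) :
    #{A : Matrix m n F | ∀ i, A.row i ∈ Submodule.span F (A.row '' I)} ≤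
      Fintype.card F ^ (#I * Fintype.card n + (Fintype.card m - #I) * #I) := by
  let fill (p : (I → n → F) × ({i // i ∉ I} → I → F)) : Matrix m n F := fun i ↦
    if h : i ∈ I then p.1 ⟨i, h⟩ else ∑ j, p.2 ⟨i, h⟩ j • p.1 j
  have hsub : ({A : Matrix m n F | ∀ i, A.row i ∈ Submodule.span F (A.row '' I)} : Finset _) ⊆
      univ.image fill := by
    intro A hA
    choose w hw using fun i ↦
      (Submodule.mem_span_image_finset_iff_exists_fun F).1 ((mem_filter.1 hA).2 i)
    refine mem_image.2 ⟨(fun j ↦ A j, fun i ↦ w i), mem_univ _, funext fun i ↦ ?_⟩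
    by_cases h : i ∈ I
    · simp only [fill, h, dite_true]
    · simp only [fill, h, dite_false]
      exact hw i
  calc _ ≤ #(univ.image fill) := card_le_card hsub
    _ ≤ Fintype.card ((I → n → F) × ({i // i ∉ I} → I → F)) := card_image_le
    _ = _ := by
      simp only [Fintype.card_prod, Fintype.card_fun, Fintype.card_coe,
        Fintype.card_subtype_compl, ← pow_mul, pow_add]
      congr 2 <;> ring

theorem card_rank_add_le_card_mul_le [DecidableEq n] (s : ℕ) :
    #{A : Matrix n n F | A.rank + s ≤ Fintype.card n} * Fintype.card F ^ s ^ 2 ≤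
      2 ^ Fintype.card n * Fintype.card F ^ Fintype.card n ^ 2 := by
  classical
  let J : Finset (Finset n) := {I | #I + s ≤ Fintype.card n}
  let E (I : Finset n) : Finset (Matrix n n F) :=
    {A | ∀ i, A.row i ∈ Submodule.span F (A.row '' I)}
  have hsub : ({A : Matrix n n F | A.rank + s ≤ Fintype.card n} : Finset _) ⊆ J.biUnion E := by
    intro A hA
    obtain ⟨I, hI, hspan⟩ := exists_finset_card_eq_rank_row_mem_span A
    simp only [mem_filter_univ, mem_biUnion, J, E] at hA ⊢
    exact ⟨I, hI ▸ hA, hspan⟩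
  have hE : ∀ I ∈ J, #(E I) * Fintype.card F ^ s ^ 2 ≤ Fintype.card F ^ Fintype.card n ^ 2 := by
    intro I hI
    obtain ⟨e, he⟩ := Nat.exists_eq_add_of_le ((mem_filter_univ I).1 hI)
    calc #(E I) * Fintype.card F ^ s ^ 2
        ≤ Fintype.card F ^ (#I * Fintype.card n + (Fintype.card n - #I) * #I) *
            Fintype.card F ^ s ^ 2 := by
          gcongr
          exact card_row_mem_span_le I
      _ ≤ Fintype.card F ^ Fintype.card n ^ 2 := by
          rw [← pow_add, show Fintype.card n - #I = s + e by lia, he]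
          exact Nat.pow_le_pow_right Fintype.card_pos
            (Nat.le.intro (k := 2 * s * e + e ^ 2) (by ring))
  calc #{A : Matrix n n F | A.rank + s ≤ Fintype.card n} * Fintype.card F ^ s ^ 2
      ≤ (∑ I ∈ J, #(E I)) * Fintype.card F ^ s ^ 2 := by
        gcongr
        exact (card_le_card hsub).trans card_biUnion_le
    _ ≤ ∑ I ∈ J, Fintype.card F ^ Fintype.card n ^ 2 := by
        rw [sum_mul]
        exact sum_le_sum hE
    _ ≤ 2 ^ Fintype.card n * Fintype.card F ^ Fintype.card n ^ 2 := by
        rw [sum_const, smul_eq_mul, ← Fintype.card_finset]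
        gcongr
        exact card_le_univ J

theorem expect_rank_add_le_card_le [DecidableEq n] (s : ℕ) :
    𝔼 A : Matrix n n F, (if A.rank + s ≤ Fintype.card n then 1 else 0 : ℝ) ≤
      2 ^ Fintype.card n / Fintype.card F ^ s ^ 2 := by
  have hcard : (Fintype.card (Matrix n n F) : ℝ) = Fintype.card F ^ Fintype.card n ^ 2 := by
    exact_mod_cast (card_eq_pow_finrank (K := F)).trans (by rw [finrank_matrix, finrank_self]; ring)
  have : (0 : ℝ) < Fintype.card F := by exact_mod_cast Fintype.card_pos
  rw [Fintype.expect_eq_sum_div_card, sum_boole, hcard,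
    div_le_div_iff₀ (by positivity) (by positivity)]
  exact_mod_cast card_rank_add_le_card_mul_le s

end Rank

section Expect

theorem expect_pow_le_expect_pow {α : Type*} (s : Finset α) {f : α → ℝ}
    (hf : ∀ i ∈ s, 0 ≤ f i) {n : ℕ} (hn : n ≠ 0) : (𝔼 i ∈ s, f i) ^ n ≤ 𝔼 i ∈ s, f i ^ n := by
  obtain ⟨n, rfl⟩ := Nat.exists_eq_succ_of_ne_zero hn
  rw [expect_eq_sum_div_card, expect_eq_sum_div_card, div_pow, Nat.succ_eq_add_one,
    pow_succ (#s : ℝ), ← div_div]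
  gcongr
  exact pow_sum_div_card_le_sum_pow hf n

variable {α β : Type*} [Fintype α] [Fintype β]

theorem expect_fin_cons {E : Type*} [AddCommMonoid E] [Module ℚ≥0 E] {m : ℕ}
    (f : (Fin (m + 1) → α) → E) :
    𝔼 x, f x = 𝔼 a, 𝔼 y : Fin m → α, f (Fin.cons a y : Fin (m + 1) → α) := by
  rw [← expect_product', univ_product_univ]
  exact (Fintype.expect_equiv (Fin.consEquiv fun _ ↦ α) _ _ fun _ ↦ rfl).symm

theorem norm_expect_mul_expect_sq_le {u : β → ℂ} (hu : ∀ b, ‖u b‖ ≤ 1) (h : α → β → ℂ) :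
    ‖𝔼 b, u b * 𝔼 a, h a b‖ ^ 2 ≤ 𝔼 a, 𝔼 a', ‖𝔼 b, h a b * conj (h a' b)‖ := by
  have hexpand : ((𝔼 b, ‖𝔼 a, h a b‖ ^ 2 : ℝ) : ℂ) =
      𝔼 a, 𝔼 a', 𝔼 b, h a b * conj (h a' b) := by
    simp_rw [Complex.ofReal_expect, Complex.ofReal_pow, ← Complex.mul_conj',
      map_expect (starRingEnd ℂ), expect_mul_expect]
    rw [expect_comm]
    exact expect_congr rfl fun a _ ↦ expect_comm _ _ _
  calc ‖𝔼 b, u b * 𝔼 a, h a b‖ ^ 2 ≤ (𝔼 b, ‖𝔼 a, h a b‖) ^ 2 := by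
        gcongr
        refine (RCLike.norm_expect_le (K := ℂ)).trans (expect_le_expect fun b _ ↦ ?_)
        rw [norm_mul]
        exact mul_le_of_le_one_left (norm_nonneg _) (hu b)
    _ ≤ 𝔼 b, ‖𝔼 a, h a b‖ ^ 2 :=
        expect_pow_le_expect_pow _ (fun _ _ ↦ norm_nonneg _) two_ne_zero
    _ = ‖𝔼 a, 𝔼 a', 𝔼 b, h a b * conj (h a' b)‖ := by
        rw [← hexpand, Complex.norm_real, Real.norm_of_nonneg (by positivity)]
    _ ≤ 𝔼 a, 𝔼 a', ‖𝔼 b, h a b * conj (h a' b)‖ :=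
        (RCLike.norm_expect_le (K := ℂ)).trans
          (expect_le_expect fun _ _ ↦ RCLike.norm_expect_le (K := ℂ))

end Expect

section BabaiNisanSzegedy

variable {R : Type*} [Fintype R]

section MonoidWithZero

variable [MonoidWithZero R] [DecidableEq R]

/-- The probability that `a * b₁ * ⋯ * bₘ = 0` for independent uniformly random
`b₁, …, bₘ : R`. -/
noncomputable def prodZeroProb (a : R) (m : ℕ) : ℝ :=
  𝔼 x : Fin m → R, if a * (List.ofFn x).prod = 0 then 1 else 0

theorem prodZeroProb_zero (a : R) : prodZeroProb a 0 = if a = 0 then 1 else 0 := by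
  simp [prodZeroProb]

theorem prodZeroProb_succ (a : R) (m : ℕ) :
    prodZeroProb a (m + 1) = 𝔼 b, prodZeroProb (a * b) m := by
  simp only [prodZeroProb, expect_fin_cons, List.ofFn_cons, List.prod_cons, mul_assoc]

theorem prodZeroProb_le_one (a : R) (m : ℕ) : prodZeroProb a m ≤ 1 :=
  expect_le univ_nonempty fun _ _ ↦ by split_ifs <;> simp

end MonoidWithZero

variable [Ring R] {χ : AddChar R ℂ}

theorem expect_prodZeroProb_mul_sub [DecidableEq R] (a : R) (m : ℕ) :
    𝔼 b, 𝔼 b', prodZeroProb (a * (b - b')) m = prodZeroProb a (m + 1) := by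
  have hshift (b : R) : 𝔼 b', prodZeroProb (a * (b - b')) m = prodZeroProb a (m + 1) := by
    rw [prodZeroProb_succ]
    exact Fintype.expect_equiv (Equiv.subLeft b) _ _ fun _ ↦ rfl
  simp only [hshift, Fintype.expect_const]

theorem norm_expect_mulShift_le [DecidableEq R] (hχ : ∀ a ≠ 0, χ.mulShift a ≠ 0)
    (a : R) : ‖𝔼 b, χ (a * b)‖ ≤ prodZeroProb a 0 := by
  simp only [← AddChar.mulShift_apply, AddChar.expect_eq_ite, prodZeroProb_zero]
  by_cases ha : a = 0
  · simp only [ha, if_true]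
    split_ifs <;> simp
  · simp [ha, hχ a ha]

theorem norm_expect_mul_prod_sq_le {m : ℕ} (a : R) {g : Fin (m + 1) → (Fin (m + 1) → R) → ℂ}
    (hg : ∀ i x, ‖g i x‖ ≤ 1) (hdep : DependsOn (g 0) {0}ᶜ) :
    ‖𝔼 x, χ (a * (List.ofFn x).prod) * ∏ i, g i x‖ ^ 2 ≤
      𝔼 b, 𝔼 b', ‖𝔼 y : Fin m → R, χ (a * (b - b') * (List.ofFn y).prod) *
        ∏ i : Fin m, (g i.succ (Fin.cons b y : Fin (m + 1) → R) *
          conj (g i.succ (Fin.cons b' y : Fin (m + 1) → R)))‖ := by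
  let h (b : R) (y : Fin m → R) : ℂ :=
    χ (a * (b * (List.ofFn y).prod)) * ∏ i : Fin m, g i.succ (Fin.cons b y : Fin (m + 1) → R)
  have hsplit : 𝔼 x, χ (a * (List.ofFn x).prod) * ∏ i, g i x =
      𝔼 y : Fin m → R, g 0 (Fin.cons 0 y : Fin (m + 1) → R) * 𝔼 b, h b y := by
    rw [expect_fin_cons, expect_comm]
    refine expect_congr rfl fun y _ ↦ ?_
    rw [mul_expect]
    refine expect_congr rfl fun b _ ↦ ?_
    have hfirst : g 0 (Fin.cons b y : Fin (m + 1) → R) = g 0 (Fin.cons 0 y : Fin (m + 1) → R) :=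
      hdep fun j hj ↦ by
        obtain ⟨j, rfl⟩ := Fin.exists_succ_eq.2 hj
        rfl
    rw [Fin.prod_univ_succ, List.ofFn_cons, List.prod_cons, hfirst]
    ring
  have hprod (b b' : R) (y : Fin m → R) : h b y * conj (h b' y) =
      χ (a * (b - b') * (List.ofFn y).prod) *
        ∏ i : Fin m, (g i.succ (Fin.cons b y : Fin (m + 1) → R) *
          conj (g i.succ (Fin.cons b' y : Fin (m + 1) → R))) := by
    have hsub : a * (b - b') * (List.ofFn y).prod =
        a * (b * (List.ofFn y).prod) + -(a * (b' * (List.ofFn y).prod)) := by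
      noncomm_ring
    rw [hsub, AddChar.map_add_eq_mul, AddChar.map_neg_eq_conj, prod_mul_distrib]
    simp only [h, map_mul, map_prod]
    ring
  rw [hsplit]
  simp only [← hprod]
  exact norm_expect_mul_expect_sq_le (fun _ ↦ hg 0 _) h

theorem dependsOn_comp_finCons {α E : Type*} {m : ℕ} {f : (Fin (m + 1) → α) → E} {i : Fin m}
    (hf : DependsOn f {i.succ}ᶜ) (a : α) :
    DependsOn (fun y : Fin m → α ↦ f (Fin.cons a y : Fin (m + 1) → α)) {i}ᶜ := by
  refine fun y z hyz ↦ hf fun j ↦ ?_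
  cases j using Fin.cases with
  | zero => simp
  | succ j => simpa using hyz j

/- The Babai–Nisan–Szegedy bound: each of the `m` Cauchy–Schwarz steps eliminates one player. -/
theorem norm_expect_mul_prod_pow_le [DecidableEq R]
    (hχ : ∀ a ≠ 0, χ.mulShift a ≠ 0)
    {m : ℕ} (a : R) {g : Fin (m + 1) → (Fin (m + 1) → R) → ℂ} (hg : ∀ i x, ‖g i x‖ ≤ 1)
    (hdep : ∀ i, DependsOn (g i) {i}ᶜ) :
    ‖𝔼 x, χ (a * (List.ofFn x).prod) * ∏ i, g i x‖ ^ 2 ^ m ≤ prodZeroProb a m := by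
  induction m generalizing a with
  | zero =>
    have hconst (x : Fin 1 → R) : g 0 x = g 0 0 :=
      hdep 0 fun j hj ↦ absurd (Fin.fin_one_eq_zero j) hj
    calc _ = ‖𝔼 b, χ (a * b)‖ * ‖g 0 0‖ := by
          rw [← norm_mul, expect_mul, expect_fin_cons]
          simp [hconst]
      _ ≤ ‖𝔼 b, χ (a * b)‖ := mul_le_of_le_one_right (norm_nonneg _) (hg 0 0)
      _ ≤ prodZeroProb a 0 := norm_expect_mulShift_le hχ a
  | succ m ih =>
    let s (b b' : R) : ℝ := ‖𝔼 y : Fin (m + 1) → R, χ (a * (b - b') * (List.ofFn y).prod) *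
        ∏ i : Fin (m + 1), (g i.succ (Fin.cons b y : Fin (m + 2) → R) *
          conj (g i.succ (Fin.cons b' y : Fin (m + 2) → R)))‖
    have hs (b b' : R) : s b b' ^ 2 ^ m ≤ prodZeroProb (a * (b - b')) m := by
      refine ih _ (fun i y ↦ ?_) fun i y z hyz ↦ ?_
      · rw [norm_mul, RCLike.norm_conj]
        exact mul_le_one₀ (hg _ _) (norm_nonneg _) (hg _ _)
      · exact congrArg₂ (fun u v ↦ u * conj v) (dependsOn_comp_finCons (hdep i.succ) b hyz)
          (dependsOn_comp_finCons (hdep i.succ) b' hyz)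
    calc _ = (‖𝔼 x, χ (a * (List.ofFn x).prod) * ∏ i, g i x‖ ^ 2) ^ 2 ^ m := by
          rw [← pow_mul, pow_succ']
      _ ≤ (𝔼 b, 𝔼 b', s b b') ^ 2 ^ m := by
          gcongr
          exact norm_expect_mul_prod_sq_le a hg (hdep 0)
      _ ≤ 𝔼 b, (𝔼 b', s b b') ^ 2 ^ m :=
          expect_pow_le_expect_pow _ (fun _ _ ↦ expect_nonneg fun _ _ ↦ norm_nonneg _)
            (by positivity)
      _ ≤ 𝔼 b, 𝔼 b', s b b' ^ 2 ^ m := by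
          gcongr
          exact expect_pow_le_expect_pow _ (fun _ _ ↦ norm_nonneg _) (by positivity)
      _ ≤ 𝔼 b : R, 𝔼 b', prodZeroProb (a * (b - b')) m := by
          gcongr
          exact hs _ _
      _ = prodZeroProb a (m + 1) := expect_prodZeroProb_mul_sub a m

end BabaiNisanSzegedy

section TraceProd

variable {n F : Type*} [Fintype n] [DecidableEq n] [Field F]

theorem mulShift_comp_trace_ne_zero {ψ : AddChar F ℂ} (hψ : ψ ≠ 0) ⦃M : Matrix n n F⦄
    (hM : M ≠ 0) : (ψ.compAddMonoidHom (Matrix.traceAddMonoidHom n F)).mulShift M ≠ 0 := by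
  contrapose! hψ with h
  obtain ⟨i, j, hij⟩ : ∃ i j, M i j ≠ 0 := by
    contrapose! hM
    exact Matrix.ext hM
  ext t
  have := DFunLike.congr_fun h (Matrix.single j i ((M i j)⁻¹ * t))
  simpa [AddChar.mulShift_apply, Matrix.trace_mul_single, hij] using this

variable [Fintype F] [DecidableEq F]

/- If `M * C₁ * ⋯ * Cₘ = 0`, then by Sylvester's inequality some `Cᵢ` has corank more than `s`. -/
theorem prodZeroProb_le_of_mul_lt_rank {m s : ℕ} {M : Matrix n n F} (hM : m * s < M.rank) :
    prodZeroProb M m ≤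
      m * 𝔼 C : Matrix n n F, (if C.rank + (s + 1) ≤ Fintype.card n then 1 else 0 : ℝ) := by
  induction m generalizing M with
  | zero =>
    have hM0 : M ≠ 0 := by
      rintro rfl
      simp at hM
    simp [prodZeroProb_zero, hM0]
  | succ m ih =>
    rw [prodZeroProb_succ, Nat.cast_succ, add_one_mul, add_comm,
      ← Fintype.expect_const (ι := Matrix n n F) (_ * _), ← expect_add_distrib]
    refine expect_le_expect fun C _ ↦ ?_
    split_ifs with hC
    · refine (prodZeroProb_le_one _ _).trans (le_add_of_nonneg_right ?_)
      positivity
    · rw [zero_add]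
      have := rank_add_rank_le_rank_mul_add_card M C
      exact ih (by rw [Nat.succ_mul] at hM; lia)

end TraceProd

section CylinderIntersection

variable {ι : Type*} {X : ι → Type*}

/-- A cylinder intersection: an intersection over the players `i` of sets in which membership does
not depend on the input of player `i`. -/
def IsCylinderIntersection (S : Set (∀ i, X i)) : Prop :=
  ∃ C : ι → Set (∀ i, X i), (∀ i, DependsOn (· ∈ C i) {i}ᶜ) ∧ S = ⋂ i, C i

namespace IsCylinderIntersection

theorem of_dependsOn {S : Set (∀ i, X i)} {i : ι} (hS : DependsOn (· ∈ S) {i}ᶜ) :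
    IsCylinderIntersection S := by
  refine ⟨fun j ↦ {x | j = i → x ∈ S}, fun j x y hxy ↦ ?_, by ext; simp⟩
  refine propext (forall_congr' ?_)
  rintro rfl
  exact (hS hxy).to_iff

theorem iInter {κ : Type*} {S : κ → Set (∀ i, X i)} (hS : ∀ k, IsCylinderIntersection (S k)) :
    IsCylinderIntersection (⋂ k, S k) := by
  choose C hdep hSC using hS
  refine ⟨fun i ↦ ⋂ k, C k i, fun i x y hxy ↦ ?_, ?_⟩
  · simp only [Set.mem_iInter]
    exact propext (forall_congr' fun k ↦ (hdep k i hxy).to_iff)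
  · simp only [hSC]
    exact Set.iInter_comm _

theorem univ : IsCylinderIntersection (Set.univ : Set (∀ i, X i)) := by
  simpa using iInter (S := fun k : Empty ↦ k.elim) fun k ↦ k.elim

theorem inter {S T : Set (∀ i, X i)} (hS : IsCylinderIntersection S)
    (hT : IsCylinderIntersection T) : IsCylinderIntersection (S ∩ T) := by
  rw [Set.inter_eq_iInter]
  exact iInter (Bool.forall_bool.2 ⟨hT, hS⟩)

end IsCylinderIntersection

end CylinderIntersection

namespace NOFProtocol

variable {ι : Type v} {X : ι → Type u}

/-- The first `t` bits written on the blackboard on the input `x`, padded with `false`. -/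
def transcript : NOFProtocol X → (t : ℕ) → (∀ j, X j) → Fin t → Bool
  | output _, _, _ => fun _ ↦ false
  | speak _ _ _, 0, _ => Fin.elim0
  | speak i bit next, t + 1, x =>
    Fin.cons (bit (view x i)) (transcript (next (bit (view x i))) t x)

theorem isCylinderIntersection_transcript_eq (P : NOFProtocol X) (t : ℕ) (x₀ : ∀ j, X j) :
    IsCylinderIntersection {x | P.transcript t x = P.transcript t x₀} := by
  induction P generalizing t with
  | output z => simpa [transcript] using .univ
  | speak i bit next ih =>
    cases t with
    | zero => simpa [transcript] using .univ
    | succ t =>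
      have hfirst : IsCylinderIntersection {x : ∀ j, X j | bit (view x i) = bit (view x₀ i)} := by
        refine .of_dependsOn (i := i) fun x y hxy ↦ ?_
        have hview : view x i = view y i := funext fun j ↦ hxy j j.2
        simp only [Set.mem_ofPred_eq, hview]
      convert hfirst.inter (ih (bit (view x₀ i)) t) using 1
      ext x
      simp only [transcript, Set.mem_ofPred_eq, Set.mem_inter_iff, Fin.cons_inj]
      exact and_congr_right fun h ↦ by rw [h]

theorem eval_eq_of_transcript_eq (P : NOFProtocol X) {t : ℕ} {x y : ∀ j, X j}
    (hx : P.bits x ≤ t) (hy : P.bits y ≤ t) (hxy : P.transcript t x = P.transcript t y) :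
    P.eval x = P.eval y := by
  induction P generalizing t with
  | output z => rfl
  | speak i bit next ih =>
    cases t with
    | zero => simp [bits] at hx
    | succ t =>
      obtain ⟨hbit, hrest⟩ := Fin.cons_inj.1 hxy
      simp only [eval, bits, hbit] at hx hy hrest ⊢
      exact ih _ (Nat.le_of_succ_le_succ hx) (Nat.le_of_succ_le_succ hy) hrest

end NOFProtocol

theorem exists_isCylinderIntersection_ncard_le {ι : Type v} {X : ι → Type u} [Finite ι]
    [Nontrivial ι] [∀ j, Finite (X j)] (f : (∀ j, X j) → Bool) :
    ∃ S : Set (∀ j, X j), IsCylinderIntersection S ∧ (∀ x ∈ S, f x = true) ∧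
      {x | f x = true}.ncard ≤ S.ncard * 2 ^ detNOF f := by
  classical
  have := Fintype.ofFinite (∀ j, X j)
  obtain ⟨P, hP⟩ := exists_protocol_detNOF f
  let τ := P.transcript (detNOF f)
  let T : Finset (∀ j, X j) := {x | f x = true}
  have hT : {x | f x = true}.ncard = #T := by rw [← Set.ncard_coe_finset, coe_filter_univ]
  rcases T.eq_empty_or_nonempty with hempty | hnonempty
  · obtain ⟨i⟩ := (inferInstance : Nonempty ι)
    exact ⟨∅, .of_dependsOn (i := i) fun _ _ _ ↦ rfl, by simp, by simp [hT, hempty]⟩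
  obtain ⟨x₀, hx₀, hmax⟩ := T.exists_max_image (fun x₀ ↦ #{x ∈ T | τ x = τ x₀}) hnonempty
  have htrue (x) (hx : τ x = τ x₀) : f x = true := by
    rw [← (hP x).1, P.eval_eq_of_transcript_eq (hP x).2 (hP x₀).2 hx, (hP x₀).1]
    exact (mem_filter_univ x₀).1 hx₀
  refine ⟨{x | τ x = τ x₀}, P.isCylinderIntersection_transcript_eq _ x₀, htrue, ?_⟩
  have hS : ({x ∈ T | τ x = τ x₀} : Set _) = {x | τ x = τ x₀} := by
    ext x
    simpa [T] using htrue x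
  calc {x | f x = true}.ncard ≤ #{x ∈ T | τ x = τ x₀} * #(T.image τ) := by
        rw [hT]
        exact card_le_mul_card_image T _ (forall_mem_image.2 hmax)
    _ ≤ {x | τ x = τ x₀}.ncard * 2 ^ detNOF f := by
        gcongr
        · rw [← hS, ← Set.ncard_coe_finset, coe_filter]
        · exact (card_le_univ _).trans (by simp)

section Discrepancy

theorem card_mul_card_filter_eq_le {Ω F : Type*} [AddCommGroup F] [Fintype F] [DecidableEq F]
    (E : Finset Ω) (A : Ω → F) (v : F) {ε : ℝ}
    (hE : ∀ ψ : AddChar F ℂ, ψ ≠ 0 → ‖∑ x ∈ E, ψ (A x)‖ ≤ ε) :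
    Fintype.card F * #{x ∈ E | A x = v} ≤ #E + (Fintype.card F - 1) * ε := by
  have hFourier : (Fintype.card F * #{x ∈ E | A x = v} : ℂ) =
      #E + ∑ ψ ∈ univ.erase (0 : AddChar F ℂ), ψ (-v) * ∑ x ∈ E, ψ (A x) := by
    have horth (x : Ω) :
        ∑ ψ : AddChar F ℂ, ψ (-v) * ψ (A x) = if A x = v then (Fintype.card F : ℂ) else 0 := by
      simp_rw [← AddChar.map_add_eq_mul, AddChar.sum_apply_eq_ite, neg_add_eq_zero, eq_comm]
    calc (Fintype.card F * #{x ∈ E | A x = v} : ℂ)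
        = ∑ ψ : AddChar F ℂ, ψ (-v) * ∑ x ∈ E, ψ (A x) := by
          simp_rw [mul_sum]
          rw [sum_comm]
          simp_rw [horth]
          rw [← sum_filter, sum_const, nsmul_eq_mul, mul_comm]
      _ = _ := by
          rw [← add_sum_erase _ _ (mem_univ (0 : AddChar F ℂ))]
          simp
  have hcard : (#(univ.erase (0 : AddChar F ℂ)) : ℝ) = Fintype.card F - 1 := by
    rw [card_erase_of_mem (mem_univ _), card_univ, AddChar.card_eq,
      Nat.cast_pred Fintype.card_pos]
  calc (Fintype.card F * #{x ∈ E | A x = v} : ℝ) = ‖(Fintype.card F * #{x ∈ E | A x = v} : ℂ)‖ := by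
        simp
    _ ≤ #E + ∑ _ψ ∈ univ.erase (0 : AddChar F ℂ), ε := by
        rw [hFourier]
        refine (norm_add_le _ _).trans (add_le_add (by simp) (norm_sum_le_of_le _ fun ψ hψ ↦ ?_))
        rw [norm_mul, AddChar.norm_apply, one_mul]
        exact hE ψ (ne_of_mem_erase hψ)
    _ = #E + (Fintype.card F - 1) * ε := by rw [sum_const, nsmul_eq_mul, hcard]

theorem norm_sum_inter_inf_compl_le {Ω κ G : Type*} [Fintype Ω] [DecidableEq Ω]
    [SeminormedAddCommGroup G] (s : Finset κ) (E : Finset Ω) (S : κ → Finset Ω) (f : Ω → G) {ε : ℝ}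
    (h : ∀ t ⊆ s, ‖∑ x ∈ E ∩ t.inf S, f x‖ ≤ ε) :
    ‖∑ x ∈ E ∩ s.inf fun k ↦ (S k)ᶜ, f x‖ ≤ 2 ^ #s * ε := by
  have hrestrict (B : Finset Ω) : ∑ x ∈ E ∩ B, f x = ∑ x ∈ B, if x ∈ E then f x else 0 := by
    rw [sum_ite_mem, inter_comm]
  rw [hrestrict, inclusion_exclusion_sum_inf_compl]
  calc ‖∑ t ∈ s.powerset, (-1) ^ #t • ∑ x ∈ t.inf S, if x ∈ E then f x else 0‖
      ≤ ∑ _t ∈ s.powerset, ε := by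
        refine norm_sum_le_of_le _ fun t ht ↦ ?_
        rw [← hrestrict]
        rcases neg_one_pow_eq_or ℤ #t with hsign | hsign <;>
          simpa [hsign] using h t (mem_powerset.1 ht)
    _ = 2 ^ #s * ε := by rw [sum_const, card_powerset, nsmul_eq_mul, Nat.cast_pow, Nat.cast_ofNat]

open Classical in
/-- `A` has cylinder-intersection character sums at most `δ`: this is the unnormalised form of a
discrepancy bound for functions with values in a finite abelian group. -/
def CylinderCharSumLE {ι F : Type*} {X : ι → Type*} [Fintype (∀ i, X i)] [AddCommGroup F]
    (A : (∀ i, X i) → F) (δ : ℝ) : Prop :=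
  ∀ ψ : AddChar F ℂ, ψ ≠ 0 → ∀ S : Set (∀ i, X i), IsCylinderIntersection S →
    ‖∑ x with x ∈ S, ψ (A x)‖ ≤ δ

/-- The input of the players of `Lift` in which `y` is on the forehead of the last player. -/
def graphPoint {X Y : Type u} {m : ℕ} (x : Fin m → X) (y : Y) :
    (j : Option (Fin m)) → GraphInput m X Y j
  | some i => x i
  | none => y

variable {X F : Type u} {m : ℕ}

theorem graphPoint_restrict (z : (j : Option (Fin m)) → GraphInput m X F j) :
    graphPoint (fun i ↦ z (some i)) (z none) = z := by
  ext (_ | i) <;> rfl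

theorem graphPoint_apply_restrict {A : (Fin m → X) → F}
    {z : (j : Option (Fin m)) → GraphInput m X F j} (hz : A (fun i ↦ z (some i)) = z none) :
    graphPoint (fun i ↦ z (some i)) (A fun i ↦ z (some i)) = z :=
  (congrArg (graphPoint fun i ↦ z (some i)) hz).trans (graphPoint_restrict z)

theorem lift_eq_true_iff {A : (Fin m → X) → F} {z : (j : Option (Fin m)) → GraphInput m X F j} :
    Lift A z = true ↔ A (fun i ↦ z (some i)) = z none := by
  classical exact decide_eq_true_iff

theorem ncard_lift_eq_true [Fintype X] (A : (Fin m → X) → F) :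
    {z | Lift A z = true}.ncard = Fintype.card X ^ m := by
  have hrange : {z | Lift A z = true} = Set.range fun x ↦ graphPoint x (A x) := by
    ext z
    refine lift_eq_true_iff.trans ⟨fun hz ↦ ⟨_, graphPoint_apply_restrict hz⟩, ?_⟩
    rintro ⟨x, rfl⟩
    rfl
  have hinj : Function.Injective fun x ↦ graphPoint x (A x) := fun x y hxy ↦
    funext fun i ↦ congrFun hxy (some i)
  rw [hrange, ← Nat.card_coe_set_eq, Nat.card_range_of_injective hinj]
  simp

/-- The inputs `x` for which no player `some i` can exclude `(x, v)` from the cylinder intersection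
`⋂ j, C j`. -/
def cylinderSlice (C : (j : Option (Fin m)) → Set ((j : Option (Fin m)) → GraphInput m X F j))
    (v : F) : Set (Fin m → X) :=
  {x | ∀ i, graphPoint x v ∈ C (some i)}

theorem isCylinderIntersection_cylinderSlice
    {C : (j : Option (Fin m)) → Set ((j : Option (Fin m)) → GraphInput m X F j)}
    (hC : ∀ j, DependsOn (· ∈ C j) {j}ᶜ) (v : F) : IsCylinderIntersection (cylinderSlice C v) := by
  refine ⟨fun i ↦ {x | graphPoint x v ∈ C (some i)}, fun i x y hxy ↦ hC (some i) ?_, ?_⟩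
  · rintro (_ | j) hj
    · rfl
    · exact hxy j fun h ↦ hj (congrArg some h)
  · ext x
    simp [cylinderSlice]

theorem mem_cylinderSlice_iff {A : (Fin m → X) → F}
    {C : (j : Option (Fin m)) → Set ((j : Option (Fin m)) → GraphInput m X F j)}
    (hC : ∀ j, DependsOn (· ∈ C j) {j}ᶜ) (hA : ∀ z ∈ ⋂ j, C j, A (fun i ↦ z (some i)) = z none)
    {x : Fin m → X} (hx : graphPoint x (A x) ∈ ⋂ j, C j) (w : F) :
    x ∈ cylinderSlice C w ↔ w = A x := by
  refine ⟨fun hw ↦ (hA (graphPoint x w) (Set.mem_iInter.2 ?_)).symm, ?_⟩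
  · rintro (_ | i)
    · refine (hC none ?_).to_iff.1 (Set.mem_iInter.1 hx none)
      rintro (_ | j) hj
      · exact absurd rfl hj
      · rfl
    · exact hw i
  · rintro rfl i
    exact Set.mem_iInter.1 hx (some i)

/-- The inputs `x` for which `v` is the only value with `(x, v)` not excluded from `⋂ j, C j` by the
players `some i`. -/
def exactCylinderSlice
    (C : (j : Option (Fin m)) → Set ((j : Option (Fin m)) → GraphInput m X F j)) (v : F) :
    Set (Fin m → X) :=
  {x | ∀ w, x ∈ cylinderSlice C w ↔ w = v}

theorem pairwise_disjoint_exactCylinderSlice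
    (C : (j : Option (Fin m)) → Set ((j : Option (Fin m)) → GraphInput m X F j)) :
    Pairwise (Function.onFun Disjoint (exactCylinderSlice C)) := fun v _ hvw ↦
  Set.disjoint_left.2 fun _ hv hw ↦ hvw ((hw v).1 ((hv v).2 rfl))

variable [Fintype X] [AddCommGroup F] [Fintype F]

open Classical in
theorem norm_sum_exactCylinderSlice_le {A : (Fin m → X) → F} {δ : ℝ} (hA : CylinderCharSumLE A δ)
    {C : (j : Option (Fin m)) → Set ((j : Option (Fin m)) → GraphInput m X F j)}
    (hC : ∀ j, DependsOn (· ∈ C j) {j}ᶜ) {ψ : AddChar F ℂ} (hψ : ψ ≠ 0) (v : F) :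
    ‖∑ x with x ∈ exactCylinderSlice C v, ψ (A x)‖ ≤ 2 ^ (Fintype.card F - 1) * δ := by
  let E (w : F) : Finset (Fin m → X) := {x | x ∈ cylinderSlice C w}
  have hexact : ({x | x ∈ exactCylinderSlice C v} : Finset (Fin m → X)) =
      E v ∩ (univ.erase v).inf fun w ↦ (E w)ᶜ := by
    ext x
    simp only [mem_filter_univ, mem_inter, mem_inf, mem_erase, mem_univ, and_true, mem_compl, E]
    change (∀ w, x ∈ cylinderSlice C w ↔ w = v) ↔ _
    refine ⟨fun h ↦ ⟨(h v).2 rfl, fun w hw hx ↦ hw ((h w).1 hx)⟩, fun ⟨hv, h⟩ w ↦ ⟨?_, ?_⟩⟩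
    · exact fun hx ↦ by_contra fun hw ↦ h w hw hx
    · rintro rfl
      exact hv
  rw [hexact, ← card_univ, ← card_erase_of_mem (mem_univ v)]
  refine norm_sum_inter_inf_compl_le _ _ _ _ fun t _ ↦ ?_
  obtain ⟨D, hD, hED⟩ : ∃ D, IsCylinderIntersection D ∧ E v ∩ t.inf E = univ.filter (· ∈ D) :=
    ⟨_, (isCylinderIntersection_cylinderSlice hC v).inter
      (.iInter fun w : t ↦ isCylinderIntersection_cylinderSlice hC w), by ext x; simp [E, mem_inf]⟩
  rw [hED]
  exact hA ψ hψ D hD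

theorem card_mul_ncard_le_of_subset_graph {A : (Fin m → X) → F} {δ : ℝ}
    (hA : CylinderCharSumLE A δ) {S : Set ((j : Option (Fin m)) → GraphInput m X F j)}
    (hS : IsCylinderIntersection S) (hgraph : ∀ z ∈ S, A (fun i ↦ z (some i)) = z none) :
    Fintype.card F * S.ncard ≤ Fintype.card X ^ m +
      Fintype.card F * ((Fintype.card F - 1) * (2 ^ (Fintype.card F - 1) * δ)) := by
  classical
  obtain ⟨C, hC, rfl⟩ := hS
  let E (v : F) : Finset (Fin m → X) := {x | x ∈ exactCylinderSlice C v}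
  let T : Finset (Fin m → X) := {x | x ∈ exactCylinderSlice C (A x)}
  have hproj : (⋂ j, C j).ncard ≤ #T := by
    rw [← Set.ncard_coe_finset]
    refine Set.ncard_le_ncard_of_injOn (fun z i ↦ z (some i)) (fun z hz ↦ ?_) fun z hz z' hz' h ↦ ?_
    · refine (mem_filter_univ _).2 fun w ↦ mem_cylinderSlice_iff hC hgraph ?_ w
      rwa [graphPoint_apply_restrict (hgraph z hz)]
    · rw [← graphPoint_apply_restrict (hgraph z hz), ← graphPoint_apply_restrict (hgraph z' hz')]
      exact congrArg (fun x ↦ graphPoint x (A x)) h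
  have hfibre (v : F) : ({x ∈ T | A x = v} : Finset _) = {x ∈ E v | A x = v} := by
    ext x
    simp only [mem_filter, T, E]
    exact and_congr_left fun h ↦ by rw [h]
  have hdisjoint : ∑ v, #(E v) ≤ Fintype.card X ^ m := by
    rw [← card_biUnion fun v _ w _ hvw ↦ ?_]
    · exact (card_le_univ _).trans (by simp)
    · simpa [E, Finset.disjoint_filter, Set.disjoint_left] using
        pairwise_disjoint_exactCylinderSlice C hvw
  calc (Fintype.card F * (⋂ j, C j).ncard : ℝ) ≤ Fintype.card F * #T := by gcongr
    _ = ∑ v, (Fintype.card F * #{x ∈ E v | A x = v} : ℝ) := by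
        rw [card_eq_sum_card_fiberwise (f := A) (t := univ) fun _ _ ↦ mem_univ _, Nat.cast_sum,
          mul_sum]
        simp only [hfibre]
    _ ≤ ∑ v, (#(E v) + (Fintype.card F - 1) * (2 ^ (Fintype.card F - 1) * δ)) :=
        sum_le_sum fun v _ ↦ card_mul_card_filter_eq_le _ _ _ fun ψ hψ ↦
          norm_sum_exactCylinderSlice_le hA hC hψ v
    _ ≤ _ := by
        rw [sum_add_distrib, sum_const, card_univ, nsmul_eq_mul]
        gcongr
        exact_mod_cast hdisjoint

instance [Finite X] [Finite F] : ∀ j, Finite (GraphInput m X F j)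
  | some _ => ‹Finite X›
  | none => ‹Finite F›

theorem natCast_sub_one_lt_of_mul_le {N : ℕ} (hN : N ≠ 0) {Q S T : ℝ} (hQ : 0 < Q) (hT : 0 ≤ T)
    (hS : N * S ≤ Q + N * ((N - 1) * (2 ^ (N - 1) * (Q / 2 ^ (4 * N))))) (hQS : Q ≤ S * T) :
    N - 1 < T := by
  have hN1 : (1 : ℝ) ≤ N := by exact_mod_cast Nat.one_le_iff_ne_zero.2 hN
  have hpow : (N : ℝ) ≤ 2 ^ N := by exact_mod_cast Nat.lt_two_pow_self.le
  by_contra! hTN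
  have herror : N * ((N - 1) * (2 ^ (N - 1) * (Q / 2 ^ (4 * N)))) * T < Q := by
    calc N * ((N - 1) * (2 ^ (N - 1) * (Q / 2 ^ (4 * N)))) * T
        ≤ 2 ^ N * (2 ^ N * (2 ^ (N - 1) * (Q / 2 ^ (4 * N)))) * 2 ^ N := by
          gcongr <;> linarith
      _ = Q * (2 ^ (N - 1) / 2 ^ N) := by
          field_simp
          ring
      _ < Q := mul_lt_of_lt_one_right hQ <| (div_lt_one (by positivity)).2 <|
          pow_lt_pow_right₀ one_lt_two (Nat.sub_one_lt hN)
  refine lt_irrefl (N * Q) ?_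
  calc N * Q ≤ N * S * T := by
        rw [mul_assoc]
        gcongr
    _ ≤ (Q + N * ((N - 1) * (2 ^ (N - 1) * (Q / 2 ^ (4 * N))))) * T := by gcongr
    _ < Q * (N - 1) + Q := by
        rw [add_mul]
        exact add_lt_add_of_le_of_lt (by gcongr) herror
    _ = N * Q := by ring

theorem card_le_two_pow_detNOF_lift [Nonempty X] (hm : m ≠ 0) {A : (Fin m → X) → F}
    (hA : CylinderCharSumLE A (Fintype.card X ^ m / 2 ^ (4 * Fintype.card F))) :
    Fintype.card F ≤ 2 ^ detNOF (Lift A) := by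
  have : Nonempty (Fin m) := ⟨⟨0, Nat.pos_of_ne_zero hm⟩⟩
  obtain ⟨S, hS, hSA, hcard⟩ := exists_isCylinderIntersection_ncard_le (Lift A)
  rw [ncard_lift_eq_true] at hcard
  have hsmall :=
    card_mul_ncard_le_of_subset_graph hA hS fun z hz ↦ lift_eq_true_iff.1 (hSA z hz)
  have hlt : (Fintype.card F : ℝ) - 1 < 2 ^ detNOF (Lift A) :=
    natCast_sub_one_lt_of_mul_le Fintype.card_ne_zero (by positivity) (by positivity) hsmall
      (by exact_mod_cast hcard)
  rw [sub_lt_iff_lt_add] at hlt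
  exact Nat.lt_succ_iff.1 (by exact_mod_cast hlt)

end Discrepancy

section MatrixProduct

open Classical in
theorem norm_expect_mul_indicator_pow_le {R : Type*} [Ring R] [Fintype R] {χ : AddChar R ℂ}
    (hχ : ∀ a ≠ 0, χ.mulShift a ≠ 0) {m : ℕ} (a : R) {S : Set (Fin (m + 1) → R)}
    (hS : IsCylinderIntersection S) :
    ‖𝔼 x, χ (a * (List.ofFn x).prod) * S.indicator 1 x‖ ^ 2 ^ m ≤ prodZeroProb a m := by
  obtain ⟨C, hC, rfl⟩ := hS
  have hprod (x : Fin (m + 1) → R) :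
      (⋂ i, C i).indicator (1 : (Fin (m + 1) → R) → ℂ) x = ∏ i, (C i).indicator 1 x := by
    simp only [Set.indicator_apply, Pi.one_apply, prod_ite_zero, Set.mem_iInter, mem_univ,
      forall_const, prod_const_one]
  simp_rw [hprod]
  refine norm_expect_mul_prod_pow_le hχ a (fun i x ↦ ?_) fun i x y hxy ↦ ?_
  · exact (norm_indicator_le_norm_self 1 x).trans (by simp)
  · simp only [Set.indicator_apply, Pi.one_apply, (hC i hxy).to_iff]

open Classical in
theorem norm_sum_mem_le_of_prodZeroProb_le {R : Type*} [Ring R] [Fintype R] {χ : AddChar R ℂ}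
    (hχ : ∀ a ≠ 0, χ.mulShift a ≠ 0) {m : ℕ} {a : R} {S : Set (Fin (m + 1) → R)}
    (hS : IsCylinderIntersection S) {ε : ℝ} (hε : 0 ≤ ε) (ha : prodZeroProb a m ≤ ε ^ 2 ^ m) :
    ‖∑ x with x ∈ S, χ (a * (List.ofFn x).prod)‖ ≤ Fintype.card R ^ (m + 1) * ε := by
  have hsum : ∑ x with x ∈ S, χ (a * (List.ofFn x).prod) = (Fintype.card R : ℂ) ^ (m + 1) *
      𝔼 x, χ (a * (List.ofFn x).prod) * S.indicator 1 x := by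
    have hcard := Fintype.card_mul_expect fun x : Fin (m + 1) → R ↦
      χ (a * (List.ofFn x).prod) * S.indicator 1 x
    rw [Fintype.card_fun, Fintype.card_fin, Nat.cast_pow] at hcard
    rw [hcard, sum_filter]
    simp only [Set.indicator_apply, Pi.one_apply, mul_ite, mul_one, mul_zero]
  rw [hsum, norm_mul, norm_pow, Complex.norm_natCast]
  gcongr
  exact le_of_pow_le_pow_left₀ (by positivity) hε
    ((norm_expect_mul_indicator_pow_le hχ a hS).trans ha)

theorem cylinderCharSumLE_traceProd {F : Type u} [Field F] [Fintype F] {d m s : ℕ}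
    (hs : m * s < d) {ε : ℝ} (hε : 0 ≤ ε)
    (hlarge : m * 2 ^ d ≤ ε ^ 2 ^ m * Fintype.card F ^ (s + 1) ^ 2) :
    CylinderCharSumLE (traceProd F d (m + 1))
      (Fintype.card (Matrix (Fin d) (Fin d) F) ^ (m + 1) * ε) := by
  classical
  intro ψ hψ S hS
  have hrank : m * s < (1 : Matrix (Fin d) (Fin d) F).rank := by simpa using hs
  have hprob : prodZeroProb (1 : Matrix (Fin d) (Fin d) F) m ≤ ε ^ 2 ^ m :=
    calc prodZeroProb (1 : Matrix (Fin d) (Fin d) F) m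
        ≤ m * 𝔼 C : Matrix (Fin d) (Fin d) F,
            (if C.rank + (s + 1) ≤ Fintype.card (Fin d) then 1 else 0 : ℝ) :=
          prodZeroProb_le_of_mul_lt_rank hrank
      _ ≤ m * (2 ^ Fintype.card (Fin d) / Fintype.card F ^ (s + 1) ^ 2) := by
          gcongr
          exact expect_rank_add_le_card_le (s + 1)
      _ ≤ ε ^ 2 ^ m := by
          rw [Fintype.card_fin, ← mul_div_assoc]
          exact div_le_of_le_mul₀ (by positivity) (by positivity) hlarge
  convert norm_sum_mem_le_of_prodZeroProb_le (mulShift_comp_trace_ne_zero hψ) hS hε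
    (a := 1) (by convert hprob) using 4
  simp [traceProd]

end MatrixProduct

section MatrixSize

theorem one_le_logb_two {N : ℕ} (hN : 2 ≤ N) : 1 ≤ Real.logb 2 N := by
  rw [Real.le_logb_iff_rpow_le one_lt_two (by positivity), Real.rpow_one]
  exact_mod_cast hN

theorem logb_two_le_self (N : ℕ) : Real.logb 2 N ≤ N := by
  rcases N.eq_zero_or_pos with rfl | hN
  · simp
  · rw [Real.logb_le_iff_le_rpow one_lt_two (by positivity), Real.rpow_natCast]
    exact_mod_cast Nat.lt_two_pow_self.le

theorem two_pow_le_pow_of_le_mul_logb {a b N : ℕ} (hN : 0 < N) (h : a ≤ b * Real.logb 2 N) :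
    (2 : ℝ) ^ a ≤ (N : ℝ) ^ b := by
  rwa [← Real.rpow_natCast, ← Real.le_logb_iff_rpow_le one_lt_two (by positivity), Real.logb_pow]

/-- The size `k ^ (3 / 2) * 2 ^ (k / 2) * √(N / log₂ N)` of the matrices for `k` players and values
in a field of order `N`, up to a constant factor and rounding. -/
noncomputable def matrixSize (k N : ℕ) : ℝ :=
  (k : ℝ) ^ (3 / 2 : ℝ) * (2 : ℝ) ^ ((k : ℝ) / 2) * √(N / Real.logb 2 N)

variable {k N : ℕ}

theorem matrixSize_sq_mul_logb (hN : 2 ≤ N) :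
    matrixSize k N ^ 2 * Real.logb 2 N = (k : ℝ) ^ 3 * 2 ^ k * N := by
  have hL : 1 ≤ Real.logb 2 N := one_le_logb_two hN
  have hk : ((k : ℝ) ^ (3 / 2 : ℝ)) ^ 2 = (k : ℝ) ^ 3 := by
    rw [← Real.rpow_mul_natCast (by positivity), ← Real.rpow_natCast]
    norm_num
  have h2 : ((2 : ℝ) ^ ((k : ℝ) / 2)) ^ 2 = 2 ^ k := by
    rw [← Real.rpow_mul_natCast (by positivity), ← Real.rpow_natCast]
    norm_num
  rw [matrixSize, mul_pow, mul_pow, hk, h2, Real.sq_sqrt (by positivity)]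
  field_simp

theorem one_le_matrixSize (hk : 1 ≤ k) (hN : 2 ≤ N) : 1 ≤ matrixSize k N := by
  have hL : 1 ≤ Real.logb 2 N := one_le_logb_two hN
  have hsqrt : 1 ≤ √(N / Real.logb 2 N) := by
    rw [Real.one_le_sqrt, one_le_div (by linarith)]
    exact logb_two_le_self N
  exact one_le_mul_of_one_le_of_one_le (one_le_mul_of_one_le_of_one_le
    (Real.one_le_rpow (by exact_mod_cast hk) (by norm_num))
    (Real.one_le_rpow one_le_two (by positivity))) hsqrt

theorem sq_le_matrixSize_mul_logb (hk : 1 ≤ k) (hN : 2 ≤ N) :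
    (k : ℝ) ^ 2 ≤ matrixSize k N * Real.logb 2 N := by
  have hL : 1 ≤ Real.logb 2 N := one_le_logb_two hN
  have hP : 1 ≤ matrixSize k N := one_le_matrixSize hk hN
  have hk2 : (k : ℝ) ≤ 2 ^ k := by exact_mod_cast Nat.lt_two_pow_self.le
  have hN1 : (1 : ℝ) ≤ N := by exact_mod_cast one_le_two.trans hN
  refine le_of_pow_le_pow_left₀ two_ne_zero (by positivity) ?_
  calc ((k : ℝ) ^ 2) ^ 2 = (k : ℝ) ^ 3 * k * 1 * 1 := by ring
    _ ≤ (k : ℝ) ^ 3 * 2 ^ k * N * Real.logb 2 N := by gcongr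
    _ = (matrixSize k N * Real.logb 2 N) ^ 2 := by
      rw [← matrixSize_sq_mul_logb hN]
      ring

theorem add_add_le_sq_mul_logb {d r : ℕ} (hk : 1 ≤ k) (hN : 2 ≤ N) (hd : 2 * matrixSize k N ≤ d)
    (hr : d ≤ r * k) : k + d + 2 ^ k * N ≤ r ^ 2 * Real.logb 2 N := by
  have hL : 1 ≤ Real.logb 2 N := one_le_logb_two hN
  have hP : 1 ≤ matrixSize k N := one_le_matrixSize hk hN
  have hlinear : 2 * (k : ℝ) ^ 2 * d ≤ d ^ 2 * Real.logb 2 N :=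
    calc 2 * (k : ℝ) ^ 2 * d ≤ 2 * (matrixSize k N * Real.logb 2 N) * d := by
          gcongr
          exact sq_le_matrixSize_mul_logb hk hN
      _ = 2 * matrixSize k N * Real.logb 2 N * d := by ring
      _ ≤ d * Real.logb 2 N * d := by gcongr
      _ = d ^ 2 * Real.logb 2 N := by ring
  have hexp : 2 * (k : ℝ) ^ 2 * (2 * k * (2 ^ k * N)) ≤ d ^ 2 * Real.logb 2 N :=
    calc 2 * (k : ℝ) ^ 2 * (2 * k * (2 ^ k * N)) = (2 * matrixSize k N) ^ 2 * Real.logb 2 N := by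
          rw [mul_pow, mul_assoc _ (matrixSize k N ^ 2), matrixSize_sq_mul_logb hN]
          ring
      _ ≤ d ^ 2 * Real.logb 2 N := by gcongr
  have hk1 : (1 : ℝ) ≤ k := by exact_mod_cast hk
  have hkN : (k : ℝ) + 2 ^ k * N ≤ 2 * k * (2 ^ k * N) := by
    have h1 : (1 : ℝ) ≤ 2 ^ k * N :=
      one_le_mul_of_one_le_of_one_le (one_le_pow₀ one_le_two)
        (by exact_mod_cast one_le_two.trans hN)
    nlinarith
  refine le_of_mul_le_mul_left (a := (k : ℝ) ^ 2) ?_ (by positivity)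
  calc (k : ℝ) ^ 2 * (k + d + 2 ^ k * N) ≤ (k : ℝ) ^ 2 * (d + 2 * k * (2 ^ k * N)) := by
        gcongr ?_ * ?_
        linarith
    _ ≤ d ^ 2 * Real.logb 2 N := by linarith
    _ ≤ (r * k) ^ 2 * Real.logb 2 N := by
        gcongr
        exact_mod_cast hr
    _ = (k : ℝ) ^ 2 * (r ^ 2 * Real.logb 2 N) := by ring

theorem logb_card_le_detNOF_lift_traceProd {F : Type u} [Field F] [Fintype F] {d : ℕ} (hk : 2 ≤ k)
    (hd : 2 * matrixSize k (Fintype.card F) ≤ d) :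
    Real.logb 2 (Fintype.card F) ≤ detNOF (Lift (traceProd F d (k - 1))) := by
  obtain ⟨m, rfl⟩ := Nat.exists_eq_add_of_le' hk
  have hN : 2 ≤ Fintype.card F := Fintype.one_lt_card
  have hd0 : 0 < d := by
    have := one_le_matrixSize (one_le_two.trans hk) hN
    exact_mod_cast (by linarith : (0 : ℝ) < d)
  obtain ⟨s, hs, hsd⟩ : ∃ s, m * s < d ∧ d ≤ (s + 1) * (m + 2) := by
    have hdiv := Nat.div_mul_le_self (d - 1) (m + 2)
    have hmod := Nat.lt_div_mul_add (a := d - 1) (b := m + 2) (by lia)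
    exact ⟨(d - 1) / (m + 2), by lia, by lia⟩
  have hlarge : (m : ℝ) * 2 ^ d ≤ (1 / 2 ^ (4 * Fintype.card F)) ^ 2 ^ m *
      Fintype.card F ^ (s + 1) ^ 2 := by
    rw [div_pow, one_pow, one_div_mul_eq_div, le_div_iff₀ (by positivity)]
    calc (m : ℝ) * 2 ^ d * (2 ^ (4 * Fintype.card F)) ^ 2 ^ m
        ≤ 2 ^ (m + 2) * 2 ^ d * (2 ^ (4 * Fintype.card F)) ^ 2 ^ m := by
          gcongr
          exact_mod_cast Nat.lt_two_pow_self.le.trans (Nat.pow_le_pow_right two_pos (by lia))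
      _ = 2 ^ (m + 2 + d + 2 ^ (m + 2) * Fintype.card F) := by
          rw [← pow_mul, ← pow_add, ← pow_add]
          ring_nf
      _ ≤ (Fintype.card F : ℝ) ^ (s + 1) ^ 2 :=
          two_pow_le_pow_of_le_mul_logb Fintype.card_pos <| by
            exact_mod_cast add_add_le_sq_mul_logb (one_le_two.trans hk) hN hd hsd
  have hcard : Fintype.card F ≤ 2 ^ detNOF (Lift (traceProd F d (m + 1))) := by
    refine card_le_two_pow_detNOF_lift m.succ_ne_zero ?_
    simpa only [mul_one_div] using cylinderCharSumLE_traceProd hs (by positivity) hlarge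
  rw [Real.logb_le_iff_le_rpow one_lt_two (by positivity), Real.rpow_natCast]
  exact_mod_cast hcard

theorem logb_logb_card_matrix_le {F : Type*} [Field F] [Fintype F] {d : ℕ} {c : ℝ} (hc : 0 < c)
    (hk : 1 ≤ k) (hd : d = ⌈c * matrixSize k (Fintype.card F)⌉₊) :
    Real.logb 2 (Real.logb 2 (Nat.card (Matrix (Fin d) (Fin d) F))) ≤
      Real.logb 2 (Fintype.card F) + k + 3 * Real.logb 2 k + 2 * Real.logb 2 (c + 1) := by
  have hN : 2 ≤ Fintype.card F := Fintype.one_lt_card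
  set N := Fintype.card F
  have hL : 1 ≤ Real.logb 2 N := one_le_logb_two hN
  have hP : 1 ≤ matrixSize k N := one_le_matrixSize hk hN
  have hd0 : 0 < d := by
    rw [hd, Nat.ceil_pos]
    positivity
  have hd1 : d ≤ (c + 1) * matrixSize k N := by
    have := (Nat.ceil_lt_add_one (a := c * matrixSize k N) (by positivity)).le
    rw [← hd] at this
    linarith
  have hlog : Real.logb 2 (Nat.card (Matrix (Fin d) (Fin d) F)) = d ^ 2 * Real.logb 2 N := by
    rw [Module.natCard_eq_pow_finrank (K := F), Nat.cast_pow, Real.logb_pow,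
      Nat.card_eq_fintype_card]
    simp [Module.finrank_matrix, N, sq]
  have : (0 : ℝ) < N := by positivity
  calc Real.logb 2 (Real.logb 2 (Nat.card (Matrix (Fin d) (Fin d) F)))
      = Real.logb 2 (d ^ 2 * Real.logb 2 N) := by rw [hlog]
    _ ≤ Real.logb 2 (((c + 1) * matrixSize k N) ^ 2 * Real.logb 2 N) := by
        refine Real.logb_le_logb_of_le one_lt_two (by positivity) ?_
        gcongr
    _ = Real.logb 2 ((c + 1) ^ 2 * (k ^ 3 * 2 ^ k * N)) := by
        rw [mul_pow, mul_assoc, matrixSize_sq_mul_logb hN]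
    _ = Real.logb 2 N + k + 3 * Real.logb 2 k + 2 * Real.logb 2 (c + 1) := by
        rw [Real.logb_mul (by positivity) (by positivity),
          Real.logb_mul (by positivity) (by positivity),
          Real.logb_mul (by positivity) (by positivity), Real.logb_pow, Real.logb_pow,
          Real.logb_pow, Real.logb_self_eq_one one_lt_two]
        push_cast
        ring

end MatrixSize

theorem corollary5 :
    ∃ c₀ : ℝ, 0 < c₀ ∧ ∀ c : ℝ, c₀ ≤ c → ∀ a : ℝ, ∃ δ : ℝ, 0 < δ ∧
      ∀ (N : ℕ), IsPrimePow N → ∀ (k : ℕ), 2 ≤ k →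
      ∀ (F : Type) [Field F] [Fintype F], Fintype.card F = N →
      ∀ (d : ℕ), d = ⌈c * (k : ℝ) ^ (3 / 2 : ℝ) * (2 : ℝ) ^ ((k : ℝ) / 2) *
          Real.sqrt ((N : ℝ) / Real.logb 2 N)⌉₊ →
      ∀ (n : ℕ), n = Nat.card (Matrix (Fin d) (Fin d) F) →
        Real.logb 2 N ≤ (detNOF (Lift (traceProd F d (k - 1))) : ℝ) ∧
        Real.logb 2 (Real.logb 2 n) - k - 3 * Real.logb 2 k - 2 * Real.logb 2 (c + 1)
          ≤ Real.logb 2 N ∧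
        ((k : ℝ) ≤ (N : ℝ) ^ a →
          δ * (Real.logb 2 (Real.logb 2 n) - k) ≤ Real.logb 2 N) ∧
        ((k : ℝ) ≤ a * Real.logb 2 N →
          δ * Real.logb 2 (Real.logb 2 n) ≤ Real.logb 2 N) := by
  refine ⟨2, two_pos, fun c hc a ↦ ?_⟩
  have hC : 0 ≤ 2 * Real.logb 2 (c + 1) :=
    mul_nonneg two_pos.le (Real.logb_nonneg one_lt_two (by linarith))
  refine ⟨(1 + 4 * |a| + 2 * Real.logb 2 (c + 1))⁻¹, by positivity, ?_⟩
  rintro N hN k hk F _ _ rfl d hd n rfl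
  have hd' : d = ⌈c * matrixSize k (Fintype.card F)⌉₊ := by
    rw [hd, matrixSize, ← mul_assoc, ← mul_assoc]
  have hL : 1 ≤ Real.logb 2 (Fintype.card F) := one_le_logb_two hN.two_le
  have hP : 1 ≤ matrixSize k (Fintype.card F) := one_le_matrixSize (by lia) hN.two_le
  have hloglog := logb_logb_card_matrix_le (by linarith) (by lia) hd'
  refine ⟨logb_card_le_detNOF_lift_traceProd hk ?_, by linarith, fun hka ↦ ?_, fun hka ↦ ?_⟩
  · exact (mul_le_mul_of_nonneg_right hc (by positivity)).trans (hd' ▸ Nat.le_ceil _)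
  · have hlogk : Real.logb 2 k ≤ a * Real.logb 2 (Fintype.card F) := by
      rw [← Real.logb_rpow_eq_mul_logb_of_pos (by positivity)]
      exact Real.logb_le_logb_of_le one_lt_two (by positivity) hka
    rw [inv_mul_le_iff₀ (by positivity)]
    nlinarith [le_abs_self a, abs_nonneg a]
  · rw [inv_mul_le_iff₀ (by positivity)]
    nlinarith [le_abs_self a, abs_nonneg a, logb_two_le_self k]
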